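/- Let $M$ be a smooth $n$-dimensional manifold. For a Lorentzian metric $g_{ij}$ on $M$ of signature $(-,+,\dots,+)$, with Levi-Civita connection $\nabla$ and Ricci tensor $R_{ij}$ (sign convention: positive on round spheres), and a vector field $u$, write $\dot S=u^m\nabla_m S$ for the derivative of a scalar field $S$ along $u$. The pair $(M,g)$ is called a generalized Robertson–Walker (GRW) space-time if there is a smooth time-like unit vector field $u$, $u^ju_j=-1$, that is torse-forming, i.e. $\nabla_k u_l=\varphi\,(g_{kl}+u_ku_l)$ for some scalar field $\varphi$, and that is an eigenvector of the Ricci tensor, i.e. $R_{jk}u^k=\xi u_j$ for some scalar field $\xi$. **Theorem 6.1.** Let $(M,g)$ be a GRW space-time, with $u$ and $\varphi$ as above, and let $\sigma$ be a smooth real function on $M$ with $\nabla_k\sigma=-u_k\dot\sigma$. Put $\bar g_{ij}=e^{2\sigma}g_{ij}$. Then $(M,\bar g)$ is a GRW space-time. More precisely, the vector field $\bar u^k=e^{-\sigma}u^k$ satisfies $\bar g_{ij}\bar u^i\bar u^j=-1$; it is torse-forming in $(M,\bar g)$, $$\bar\nabla_i\bar u_j=\bar\varphi\,(\bar g_{ij}+\bar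 u_i\bar u_j),\qquad \bar\varphi=e^{-\sigma}(\varphi+\dot\sigma),$$ where $\bar\nabla$ is the Levi-Civita connection of $\bar g$ and $\bar u_j=\bar g_{jk}\bar u^k$; and it is an eigenvector of the Ricci tensor $\bar R_{ij}$ of $\bar g$. Moreover $$\bar R_{ij}=R_{ij}+(n-2)\big[\varphi\dot\sigma+\dot\sigma^2-\ddot\sigma\big]u_iu_j+\big[(2n-3)\varphi\dot\sigma+(n-2)\dot\sigma^2+\ddot\sigma\big]g_{ij},$$ where $\dot\sigma=u^m\nabla_m\sigma$ and $\ddot\sigma=u^m\nabla_m\dot\sigma$. -/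

import Mathlib

open scoped Manifold ContDiff
open Bundle

noncomputable section

namespace GRW

/-! ### Tensor calculus in coordinates

Here `G`, `w` are the component functions, on a coordinate domain of `ℝⁿ`, of a metric tensor
and of a covector field. -/

/-- The partial derivative `∂ᵢ f` at the coordinate point `z`. -/
def pderiv {n : ℕ} (i : Fin n) (f : EuclideanSpace ℝ (Fin n) → ℝ)
    (z : EuclideanSpace ℝ (Fin n)) : ℝ :=
  fderiv ℝ f z (EuclideanSpace.single i 1)

/-- The Christoffel symbol
`Γᵐᵢⱼ = ½ ∑ₚ gᵐᵖ (∂ᵢ gₚⱼ + ∂ⱼ gₚᵢ - ∂ₚ gᵢⱼ)` of the Levi-Civita connection. -/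
def christoffel {n : ℕ} (G : EuclideanSpace ℝ (Fin n) → Matrix (Fin n) (Fin n) ℝ)
    (m i j : Fin n) (z : EuclideanSpace ℝ (Fin n)) : ℝ :=
  (1 / 2 : ℝ) * ∑ p, (G z)⁻¹ m p *
    (pderiv i (fun y => G y p j) z + pderiv j (fun y => G y p i) z
      - pderiv p (fun y => G y i j) z)

/-- The covariant derivative `∇ₖ wₗ = ∂ₖ wₗ - ∑ₘ Γᵐₖₗ wₘ` of a covector field. -/
def covDeriv {n : ℕ} (G : EuclideanSpace ℝ (Fin n) → Matrix (Fin n) (Fin n) ℝ)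
    (w : Fin n → EuclideanSpace ℝ (Fin n) → ℝ)
    (k l : Fin n) (z : EuclideanSpace ℝ (Fin n)) : ℝ :=
  pderiv k (w l) z - ∑ m, christoffel G m k l z * w m z

/-- The Ricci tensor
`Rⱼₖ = ∂ₘ Γᵐⱼₖ - ∂ⱼ Γᵐₘₖ + Γᵐₘₚ Γᵖⱼₖ - Γᵐⱼₚ Γᵖₘₖ` (summed over `m`, `p`), with the sign for
which round spheres have positive Ricci curvature. -/
def ricci {n : ℕ} (G : EuclideanSpace ℝ (Fin n) → Matrix (Fin n) (Fin n) ℝ)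
    (j k : Fin n) (z : EuclideanSpace ℝ (Fin n)) : ℝ :=
  (∑ m, pderiv m (christoffel G m j k) z)
    - (∑ m, pderiv j (christoffel G m m k) z)
    + (∑ m, ∑ p, christoffel G m m p z * christoffel G p j k z)
    - ∑ m, ∑ p, christoffel G m j p z * christoffel G p m k z

/-! ### Fields on a manifold and their components in a chart -/

section Manifold

variable {n : ℕ} {M : Type*} [TopologicalSpace M] [ChartedSpace (EuclideanSpace ℝ (Fin n)) M]

/-- The coordinate vector `∂ᵢ` of the chart `e` at the point with coordinates `z`. -/
def coordVec (e : OpenPartialHomeomorph M (EuclideanSpace ℝ (Fin n))) (i : Fin n)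
    (z : EuclideanSpace ℝ (Fin n)) : TangentSpace (𝓡 n) (e.symm z) :=
  mfderiv (𝓡 n) (𝓡 n) e.symm z (EuclideanSpace.single i (1 : ℝ))

/-- The components `gᵢⱼ` in the chart `e` of a field `g` of bilinear forms on the tangent
spaces. -/
def metricComp
    (g : ∀ x : M, TangentSpace (𝓡 n) x →L[ℝ] TangentSpace (𝓡 n) x →L[ℝ] ℝ)
    (e : OpenPartialHomeomorph M (EuclideanSpace ℝ (Fin n)))
    (z : EuclideanSpace ℝ (Fin n)) : Matrix (Fin n) (Fin n) ℝ :=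
  Matrix.of fun i j => g (e.symm z) (coordVec e i z) (coordVec e j z)

/-- The contravariant components `uⁱ` of a vector field in the chart `e`. -/
def upperComp (u : ∀ x : M, TangentSpace (𝓡 n) x)
    (e : OpenPartialHomeomorph M (EuclideanSpace ℝ (Fin n))) (i : Fin n)
    (z : EuclideanSpace ℝ (Fin n)) : ℝ :=
  let v : EuclideanSpace ℝ (Fin n) := mfderiv (𝓡 n) (𝓡 n) e (e.symm z) (u (e.symm z))
  v i

/-- The covariant components `uᵢ = g(u, ∂ᵢ)` of a vector field in the chart `e`. -/
def lowerComp
    (g : ∀ x : M, TangentSpace (𝓡 n) x →L[ℝ] TangentSpace (𝓡 n) x →L[ℝ] ℝ)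
    (u : ∀ x : M, TangentSpace (𝓡 n) x)
    (e : OpenPartialHomeomorph M (EuclideanSpace ℝ (Fin n))) (i : Fin n)
    (z : EuclideanSpace ℝ (Fin n)) : ℝ :=
  g (e.symm z) (u (e.symm z)) (coordVec e i z)

/-- The derivative `Ṡ = uᵐ ∇ₘ S` of a scalar field `S` along `u`. -/
def dot (u : ∀ x : M, TangentSpace (𝓡 n) x) (S : M → ℝ) (x : M) : ℝ :=
  mfderiv (𝓡 n) 𝓘(ℝ, ℝ) S x (u x)

/-- The rescaled metric `e^{2σ} g`. -/
def conformal (σ : M → ℝ)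
    (g : ∀ x : M, TangentSpace (𝓡 n) x →L[ℝ] TangentSpace (𝓡 n) x →L[ℝ] ℝ) :
    ∀ x : M, TangentSpace (𝓡 n) x →L[ℝ] TangentSpace (𝓡 n) x →L[ℝ] ℝ :=
  fun x => Real.exp (2 * σ x) • g x

/-- The rescaled vector field `e^{-σ} u`. -/
def rescale (σ : M → ℝ) (u : ∀ x : M, TangentSpace (𝓡 n) x) :
    ∀ x : M, TangentSpace (𝓡 n) x :=
  fun x => Real.exp (-σ x) • u x

variable [IsManifold (𝓡 n) ∞ M]

/-- A smooth Lorentzian metric, of signature `(-,+,…,+)`. -/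
structure IsLorentzianMetric
    (g : ∀ x : M, TangentSpace (𝓡 n) x →L[ℝ] TangentSpace (𝓡 n) x →L[ℝ] ℝ) : Prop where
  smooth : ContMDiff (𝓡 n)
    ((𝓡 n).prod 𝓘(ℝ, EuclideanSpace ℝ (Fin n) →L[ℝ] EuclideanSpace ℝ (Fin n) →L[ℝ] ℝ)) ∞
    (fun x => TotalSpace.mk'
      (EuclideanSpace ℝ (Fin n) →L[ℝ] EuclideanSpace ℝ (Fin n) →L[ℝ] ℝ) (E := fun x : M =>
        TangentSpace (𝓡 n) x →L[ℝ] TangentSpace (𝓡 n) x →L[ℝ] ℝ) x (g x))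
  symm : ∀ (x : M) (v w : TangentSpace (𝓡 n) x), g x v w = g x w v
  signature : ∀ x : M, ∃ v : TangentSpace (𝓡 n) x, g x v v < 0 ∧
    ∀ w : TangentSpace (𝓡 n) x, w ≠ 0 → g x v w = 0 → 0 < g x w w

/-- The torse-forming condition `∇ₖ uₗ = φ (gₖₗ + uₖ uₗ)`, in all charts of the smooth
structure. -/
def IsTorseForming
    (g : ∀ x : M, TangentSpace (𝓡 n) x →L[ℝ] TangentSpace (𝓡 n) x →L[ℝ] ℝ)
    (u : ∀ x : M, TangentSpace (𝓡 n) x) (φ : M → ℝ) : Prop :=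
  ∀ e ∈ IsManifold.maximalAtlas (𝓡 n) ∞ M, ∀ z ∈ e.target, ∀ k l : Fin n,
    covDeriv (metricComp g e) (lowerComp g u e) k l z =
      φ (e.symm z) * (metricComp g e z k l + lowerComp g u e k z * lowerComp g u e l z)

/-- The eigenvector condition `Rⱼₖ uᵏ = ξ uⱼ`, in all charts of the smooth structure. -/
def IsRicciEigenvector
    (g : ∀ x : M, TangentSpace (𝓡 n) x →L[ℝ] TangentSpace (𝓡 n) x →L[ℝ] ℝ)
    (u : ∀ x : M, TangentSpace (𝓡 n) x) (ξ : M → ℝ) : Prop :=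
  ∀ e ∈ IsManifold.maximalAtlas (𝓡 n) ∞ M, ∀ z ∈ e.target, ∀ j : Fin n,
    ∑ k, ricci (metricComp g e) j k z * upperComp u e k z =
      ξ (e.symm z) * lowerComp g u e j z

/-- `(M, g)` is a generalized Robertson-Walker space-time with time-like unit torse-forming
vector field `u` and torse-forming scalar `φ`. -/
structure IsGRWWith
    (g : ∀ x : M, TangentSpace (𝓡 n) x →L[ℝ] TangentSpace (𝓡 n) x →L[ℝ] ℝ)
    (u : ∀ x : M, TangentSpace (𝓡 n) x) (φ : M → ℝ) : Prop where
  metric : IsLorentzianMetric g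
  smooth : ContMDiff (𝓡 n) (𝓡 n).tangent ∞
    (fun x => (⟨x, u x⟩ : TangentBundle (𝓡 n) M))
  unit : ∀ x : M, g x (u x) (u x) = -1
  torse : IsTorseForming g u φ
  eigen : ∃ ξ : M → ℝ, IsRicciEigenvector g u ξ

/-- `(M, g)` is a generalized Robertson-Walker space-time. -/
def IsGRW
    (g : ∀ x : M, TangentSpace (𝓡 n) x →L[ℝ] TangentSpace (𝓡 n) x →L[ℝ] ℝ) : Prop :=
  ∃ (u : ∀ x : M, TangentSpace (𝓡 n) x) (φ : M → ℝ), IsGRWWith g u φ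

end Manifold

end GRW

end

/-! Everything is local: in a chart, write `w`, `U` for the components of `u`, `S` for σ and `s` for
its derivative along `u`, so that ∂S = -s w. The standard conformal change of the Christoffel
symbols is then Γ̄ = Γ - s D with Dᵐᵢⱼ = δᵐⱼ wᵢ + δᵐᵢ wⱼ - gᵢⱼ Uᵐ (`christoffel_conformal`).
Contracting D with w gives 2 w w + g, because `u` has norm -1, and the torse-forming equation for ū
follows (`covDeriv_conformal`).

For the Ricci tensor, Γ - s D is substituted in its four terms. The derivatives that occur are
known: those of `w` and `U` by the torse-forming equation (`pderiv_lower`, `pderiv_upper`), and that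
of `s` by symmetry of second derivatives, which forces ∂s to be a multiple of w (`pderiv_dot`). The
products of Γ with D cancel in the total, and what remains is a combination of w w and g
(`ricci_conformal`).

A Ricci correction A w w + B g maps `u` to (B - A) w, so `u` remains an eigenvector. The passage to
M requires that the components be smooth in every chart and that the metric matrix be invertible
there. -/

namespace GRW

/-! ### Partial derivatives and smoothness of matrix entries -/

section Coordinates

variable {n : ℕ}

lemma pderiv_congr {i : Fin n} {f h : EuclideanSpace ℝ (Fin n) → ℝ}
    {Ω : Set (EuclideanSpace ℝ (Fin n))} (hΩ : IsOpen Ω) (hfh : ∀ y ∈ Ω, f y = h y)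
    {z : EuclideanSpace ℝ (Fin n)} (hz : z ∈ Ω) : pderiv i f z = pderiv i h z := by
  have : f =ᶠ[nhds z] h := Filter.eventuallyEq_of_mem (hΩ.mem_nhds hz) hfh
  simp only [pderiv, this.fderiv_eq]

lemma pderiv_add {i : Fin n} {f h : EuclideanSpace ℝ (Fin n) → ℝ} {z : EuclideanSpace ℝ (Fin n)}
    (hf : DifferentiableAt ℝ f z) (hh : DifferentiableAt ℝ h z) :
    pderiv i (fun y => f y + h y) z = pderiv i f z + pderiv i h z := by
  simp [pderiv, fderiv_fun_add hf hh]

lemma pderiv_sub {i : Fin n} {f h : EuclideanSpace ℝ (Fin n) → ℝ} {z : EuclideanSpace ℝ (Fin n)}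
    (hf : DifferentiableAt ℝ f z) (hh : DifferentiableAt ℝ h z) :
    pderiv i (fun y => f y - h y) z = pderiv i f z - pderiv i h z := by
  simp [pderiv, fderiv_fun_sub hf hh]

lemma pderiv_neg {i : Fin n} {f : EuclideanSpace ℝ (Fin n) → ℝ} {z : EuclideanSpace ℝ (Fin n)} :
    pderiv i (fun y => -f y) z = -pderiv i f z := by
  simp [pderiv, fderiv_fun_neg]

lemma pderiv_mul {i : Fin n} {f h : EuclideanSpace ℝ (Fin n) → ℝ} {z : EuclideanSpace ℝ (Fin n)}
    (hf : DifferentiableAt ℝ f z) (hh : DifferentiableAt ℝ h z) :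
    pderiv i (fun y => f y * h y) z = pderiv i f z * h z + f z * pderiv i h z := by
  simp [pderiv, fderiv_fun_mul hf hh]; ring

lemma pderiv_const_mul {i : Fin n} (c : ℝ) {h : EuclideanSpace ℝ (Fin n) → ℝ}
    {z : EuclideanSpace ℝ (Fin n)} (hh : DifferentiableAt ℝ h z) :
    pderiv i (fun y => c * h y) z = c * pderiv i h z := by
  simp [pderiv, fderiv_const_mul hh]

lemma pderiv_sum {ι : Type*} [Fintype ι] {i : Fin n} {f : ι → EuclideanSpace ℝ (Fin n) → ℝ}
    {z : EuclideanSpace ℝ (Fin n)} (hf : ∀ a, DifferentiableAt ℝ (f a) z) :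
    pderiv i (fun y => ∑ a, f a y) z = ∑ a, pderiv i (f a) z := by
  simp [pderiv, fderiv_fun_sum fun a _ => hf a]

lemma pderiv_exp {i : Fin n} {f : EuclideanSpace ℝ (Fin n) → ℝ} {z : EuclideanSpace ℝ (Fin n)}
    (hf : DifferentiableAt ℝ f z) :
    pderiv i (fun y => Real.exp (f y)) z = Real.exp (f z) * pderiv i f z := by
  simp [pderiv, fderiv_exp hf]

lemma contDiffOn_pderiv {i : Fin n} {f : EuclideanSpace ℝ (Fin n) → ℝ}
    {Ω : Set (EuclideanSpace ℝ (Fin n))} (hΩ : IsOpen Ω) (hf : ContDiffOn ℝ ∞ f Ω) :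
    ContDiffOn ℝ ∞ (pderiv i f) Ω :=
  (hf.fderiv_of_isOpen hΩ (m := ∞) (by simp)).clm_apply contDiffOn_const

lemma pderiv_comm {f : EuclideanSpace ℝ (Fin n) → ℝ}
    {Ω : Set (EuclideanSpace ℝ (Fin n))} (hΩ : IsOpen Ω) (hf : ContDiffOn ℝ ∞ f Ω)
    {z : EuclideanSpace ℝ (Fin n)} (hz : z ∈ Ω) (i j : Fin n) :
    pderiv i (pderiv j f) z = pderiv j (pderiv i f) z := by
  have hd : DifferentiableAt ℝ (fderiv ℝ f) z :=
    ((hf.fderiv_of_isOpen hΩ (m := ∞) (by simp)).contDiffAt (hΩ.mem_nhds hz)).differentiableAt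
      (by simp)
  have key : ∀ a b : Fin n, pderiv a (pderiv b f) z =
      fderiv ℝ (fderiv ℝ f) z (EuclideanSpace.single a 1) (EuclideanSpace.single b 1) := by
    intro a b
    unfold pderiv
    rw [fderiv_clm_apply hd (differentiableAt_const _)]
    simp
  rw [key, key]
  exact ((hf.contDiffAt (hΩ.mem_nhds hz)).isSymmSndFDerivAt (by simpa using WithTop.coe_le_coe.2 (le_top (a := (2 : ℕ∞))))).eq _ _

lemma contDiffOn_det {m : ℕ} {E : Type*} [NormedAddCommGroup E] [NormedSpace ℝ E] {Ω : Set E}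
    {A : E → Matrix (Fin m) (Fin m) ℝ} (hA : ∀ i j, ContDiffOn ℝ ∞ (fun y => A y i j) Ω) :
    ContDiffOn ℝ ∞ (fun y => (A y).det) Ω := by
  simp only [Matrix.det_apply']
  exact ContDiffOn.sum fun τ _ => contDiffOn_const.mul (contDiffOn_prod fun i _ => hA _ _)

/-- Cramer's rule: an entry of the inverse is a cofactor, polynomial in the entries, divided by the
determinant. -/
lemma contDiffOn_inv_apply {m : ℕ} {E : Type*} [NormedAddCommGroup E] [NormedSpace ℝ E] {Ω : Set E}
    {A : E → Matrix (Fin m) (Fin m) ℝ} (hA : ∀ i j, ContDiffOn ℝ ∞ (fun y => A y i j) Ω)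
    (hdet : ∀ y ∈ Ω, (A y).det ≠ 0) (i j : Fin m) :
    ContDiffOn ℝ ∞ (fun y => (A y)⁻¹ i j) Ω := by
  simp only [Matrix.inv_def, Ring.inverse_eq_inv', Matrix.smul_apply, smul_eq_mul,
    Matrix.adjugate_apply]
  refine ((contDiffOn_det hA).inv hdet).mul (contDiffOn_det fun a b => ?_)
  by_cases h : a = j
  · subst h; simpa using contDiffOn_const
  · simpa [Matrix.updateRow_ne h] using hA a b

/-! ### The Levi-Civita connection in coordinates -/

lemma contDiffOn_christoffel {Ω : Set (EuclideanSpace ℝ (Fin n))} (hΩ : IsOpen Ω)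
    {G : EuclideanSpace ℝ (Fin n) → Matrix (Fin n) (Fin n) ℝ}
    (hG : ∀ i j, ContDiffOn ℝ ∞ (fun y => G y i j) Ω) (hdet : ∀ y ∈ Ω, (G y).det ≠ 0)
    (m i j : Fin n) : ContDiffOn ℝ ∞ (christoffel G m i j) Ω := by
  unfold christoffel
  exact contDiffOn_const.mul <| ContDiffOn.sum fun p _ =>
    (contDiffOn_inv_apply hG hdet m p).mul <|
      ((contDiffOn_pderiv hΩ (hG p j)).add (contDiffOn_pderiv hΩ (hG p i))).sub
        (contDiffOn_pderiv hΩ (hG i j))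

/-- Symmetry of `G` is assumed at every point, not only on a domain, so that indices can be
exchanged inside `pderiv`. -/
lemma christoffel_comm {G : EuclideanSpace ℝ (Fin n) → Matrix (Fin n) (Fin n) ℝ}
    (hG : ∀ y i j, G y i j = G y j i) (m i j : Fin n) (z : EuclideanSpace ℝ (Fin n)) :
    christoffel G m i j z = christoffel G m j i z := by
  unfold christoffel
  congr 1
  refine Finset.sum_congr rfl fun p _ => ?_
  simp only [fun y => hG y i j]
  ring

lemma sum_metric_mul_christoffel {G : EuclideanSpace ℝ (Fin n) → Matrix (Fin n) (Fin n) ℝ}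
    {z : EuclideanSpace ℝ (Fin n)} (hdet : (G z).det ≠ 0) (l i j : Fin n) :
    ∑ m, G z l m * christoffel G m i j z =
      (1 / 2 : ℝ) * (pderiv i (fun y => G y l j) z + pderiv j (fun y => G y l i) z
      - pderiv l (fun y => G y i j) z) := by
  set A : Fin n → ℝ := fun p => pderiv i (fun y => G y p j) z + pderiv j (fun y => G y p i) z
      - pderiv p (fun y => G y i j) z with hA
  have h1 : ∑ m, G z l m * christoffel G m i j z =
      (1 / 2 : ℝ) * ((G z).mulVec ((G z)⁻¹.mulVec A)) l := by
    simp only [christoffel, Matrix.mulVec, dotProduct, Finset.mul_sum, hA]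
    exact Finset.sum_congr rfl fun m _ => Finset.sum_congr rfl fun p _ => by ring
  rw [h1, Matrix.mulVec_mulVec, Matrix.mul_nonsing_inv _ (isUnit_iff_ne_zero.2 hdet),
    Matrix.one_mulVec]

/-- Metric compatibility of the Levi-Civita connection. -/
lemma pderiv_metric {G : EuclideanSpace ℝ (Fin n) → Matrix (Fin n) (Fin n) ℝ}
    (hG : ∀ y i j, G y i j = G y j i) {z : EuclideanSpace ℝ (Fin n)} (hdet : (G z).det ≠ 0)
    (k i j : Fin n) :
    pderiv k (fun y => G y i j) z =
      ∑ m, G z i m * christoffel G m k j z + ∑ m, G z j m * christoffel G m k i z := by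
  rw [sum_metric_mul_christoffel hdet, sum_metric_mul_christoffel hdet]
  simp only [fun y => hG y j i, fun y => hG y k j, fun y => hG y k i]
  ring

/-- The components, on a coordinate domain `Ω`, of a metric `G`, a unit time-like torse-forming
vector field with components `U` and `w`, and a scalar field `S` with gradient `-s w`. -/
structure IsTorseFormingOn (Ω : Set (EuclideanSpace ℝ (Fin n)))
    (G : EuclideanSpace ℝ (Fin n) → Matrix (Fin n) (Fin n) ℝ)
    (U w : Fin n → EuclideanSpace ℝ (Fin n) → ℝ) (φ S s : EuclideanSpace ℝ (Fin n) → ℝ) :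
    Prop where
  isOpen : IsOpen Ω
  symm : ∀ y i j, G y i j = G y j i
  contDiffOn_metric : ∀ i j, ContDiffOn ℝ ∞ (fun y => G y i j) Ω
  det_ne_zero : ∀ y ∈ Ω, (G y).det ≠ 0
  contDiffOn_upper : ∀ i, ContDiffOn ℝ ∞ (U i) Ω
  lower_eq : ∀ y ∈ Ω, ∀ i, w i y = ∑ j, G y i j * U j y
  unit : ∀ y ∈ Ω, ∑ i, w i y * U i y = -1
  torse : ∀ y ∈ Ω, ∀ k l, covDeriv G w k l y = φ y * (G y k l + w k y * w l y)
  contDiffOn_potential : ContDiffOn ℝ ∞ S Ω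
  contDiffOn_dot : ContDiffOn ℝ ∞ s Ω
  grad : ∀ y ∈ Ω, ∀ i, pderiv i S y = -(w i y * s y)

/-! ### Derivatives of a torse-forming field and of the potential -/

namespace IsTorseFormingOn

variable {Ω : Set (EuclideanSpace ℝ (Fin n))}
  {G : EuclideanSpace ℝ (Fin n) → Matrix (Fin n) (Fin n) ℝ}
  {U w : Fin n → EuclideanSpace ℝ (Fin n) → ℝ} {φ S s : EuclideanSpace ℝ (Fin n) → ℝ}
  {z : EuclideanSpace ℝ (Fin n)}

lemma contDiffOn_lower (h : IsTorseFormingOn Ω G U w φ S s) (i : Fin n) :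
    ContDiffOn ℝ ∞ (w i) Ω :=
  (ContDiffOn.sum fun j _ => (h.contDiffOn_metric i j).mul (h.contDiffOn_upper j)).congr
    fun y hy => h.lower_eq y hy i

lemma differentiableAt {f : EuclideanSpace ℝ (Fin n) → ℝ} (h : IsTorseFormingOn Ω G U w φ S s)
    (hf : ContDiffOn ℝ ∞ f Ω) (hz : z ∈ Ω) : DifferentiableAt ℝ f z :=
  (hf.contDiffAt (h.isOpen.mem_nhds hz)).differentiableAt (by simp)

lemma sum_inv_mul_lower (h : IsTorseFormingOn Ω G U w φ S s) (hz : z ∈ Ω) (m : Fin n) :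
    ∑ p, (G z)⁻¹ m p * w p z = U m z := by
  have : ∑ p, (G z)⁻¹ m p * w p z = ((G z)⁻¹.mulVec ((G z).mulVec fun j => U j z)) m := by
    simp only [Matrix.mulVec, dotProduct, h.lower_eq z hz]
  rw [this, Matrix.mulVec_mulVec,
    Matrix.nonsing_inv_mul _ (isUnit_iff_ne_zero.2 (h.det_ne_zero z hz)), Matrix.one_mulVec]

lemma pderiv_lower (h : IsTorseFormingOn Ω G U w φ S s) (hz : z ∈ Ω) (k l : Fin n) :
    pderiv k (w l) z =
      ∑ m, christoffel G m k l z * w m z + φ z * (G z k l + w k z * w l z) := by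
  rw [← h.torse z hz, covDeriv]; ring

/-- This is ∇ₖ Uᵐ = φ (δᵐₖ + wₖ Uᵐ), the torse-forming equation with an index raised.
Differentiating w = G U by metric compatibility shows that both sides agree after multiplication by
`G`, which is invertible. -/
lemma pderiv_upper (h : IsTorseFormingOn Ω G U w φ S s) (hz : z ∈ Ω) (k m : Fin n) :
    pderiv k (U m) z =
      -∑ p, christoffel G m k p z * U p z
        + φ z * ((1 : Matrix (Fin n) (Fin n) ℝ) m k + w k z * U m z) := by
  have hdet := h.det_ne_zero z hz
  set V : Fin n → ℝ := fun m => -∑ p, christoffel G m k p z * U p z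
        + φ z * ((1 : Matrix (Fin n) (Fin n) ℝ) m k + w k z * U m z) with hV
  have key : (G z).mulVec (fun m => pderiv k (U m) z) = (G z).mulVec V := by
    ext l
    have h1 := h.pderiv_lower hz k l
    rw [pderiv_congr h.isOpen (fun y hy => h.lower_eq y hy l) hz,
      pderiv_sum (f := fun j y => G y l j * U j y) fun j => (h.differentiableAt (h.contDiffOn_metric l j) hz).mul
        (h.differentiableAt (h.contDiffOn_upper j) hz)] at h1
    simp only [fun j => pderiv_mul (i := k) (h.differentiableAt (h.contDiffOn_metric l j) hz)
        (h.differentiableAt (h.contDiffOn_upper j) hz), pderiv_metric h.symm hdet,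
        Finset.sum_add_distrib, add_mul] at h1
    have e1 : ∑ x, (∑ m, G z x m * christoffel G m k l z) * U x z =
        ∑ m, christoffel G m k l z * w m z := by
      simp only [Finset.sum_mul, h.lower_eq z hz, Finset.mul_sum]
      rw [Finset.sum_comm]
      exact Finset.sum_congr rfl fun a _ => Finset.sum_congr rfl fun b _ => by
        rw [h.symm z b a]; ring
    have e2 : ∑ x, (∑ m, G z l m * christoffel G m k x z) * U x z =
        ∑ m, G z l m * ∑ p, christoffel G m k p z * U p z := by
      simp only [Finset.sum_mul, Finset.mul_sum]
      rw [Finset.sum_comm]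
      exact Finset.sum_congr rfl fun a _ => Finset.sum_congr rfl fun b _ => by ring
    have e3 : ∑ x, G z l x * (φ z * ((1 : Matrix (Fin n) (Fin n) ℝ) x k + w k z * U x z)) =
        φ z * (G z k l + w k z * w l z) := by
      rw [h.lower_eq z hz l, h.symm z k l]
      simp only [mul_add, Finset.sum_add_distrib, Finset.mul_sum, Matrix.one_apply, mul_ite,
        mul_one, mul_zero, Finset.sum_ite_eq', Finset.mem_univ, if_true]
      congr 1
      · ring
      · exact Finset.sum_congr rfl fun a _ => by ring
    rw [e1, e2] at h1
    simp only [Matrix.mulVec, dotProduct, hV, mul_add (G z l _), Finset.sum_add_distrib, e3, mul_neg,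
      Finset.sum_neg_distrib]
    linarith
  have := congrArg (fun v => (G z)⁻¹.mulVec v) key
  simp only [Matrix.mulVec_mulVec, Matrix.nonsing_inv_mul _ (isUnit_iff_ne_zero.2 hdet),
    Matrix.one_mulVec] at this
  exact congrFun this m

/-- The gradient of `s` is again proportional to `w`. This makes its contribution to the Ricci
tensor a combination of w w and g. -/
lemma pderiv_dot (h : IsTorseFormingOn Ω G U w φ S s) (hz : z ∈ Ω) (j : Fin n) :
    pderiv j s z = -(w j z * ∑ i, U i z * pderiv i s z) := by
  have hd : ∀ a b, pderiv a (pderiv b S) z = -(pderiv a (w b) z * s z + w b z * pderiv a s z) := by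
    intro a b
    rw [pderiv_congr h.isOpen (fun y hy => h.grad y hy b) hz, pderiv_neg,
      pderiv_mul (h.differentiableAt (h.contDiffOn_lower b) hz)
        (h.differentiableAt h.contDiffOn_dot hz)]
  -- The torse-forming equation and the symmetry of Γ make ∂ᵢ wⱼ symmetric, so symmetry of ∂ᵢ∂ⱼ S =
  -- -∂ᵢ(s wⱼ) leaves only this relation. Contracting it with Uⁱ and using w · U = -1 gives the
  -- claim.
  have hs : ∀ i, w i z * pderiv j s z = w j z * pderiv i s z := by
    intro i
    have := pderiv_comm h.isOpen h.contDiffOn_potential hz i j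
    rw [hd, hd, h.pderiv_lower hz, h.pderiv_lower hz, h.symm z j i] at this
    simp only [fun m => christoffel_comm h.symm m j i z] at this
    linarith
  have : (∑ i, w i z * U i z) * pderiv j s z = w j z * ∑ i, U i z * pderiv i s z := by
    rw [Finset.sum_mul, Finset.mul_sum]
    exact Finset.sum_congr rfl fun i _ => by linear_combination U i z * hs i
  rw [h.unit z hz] at this
  linarith

/-! ### Conformal change of the connection -/

lemma christoffel_conformal (h : IsTorseFormingOn Ω G U w φ S s) (hz : z ∈ Ω) (m i j : Fin n) :
    christoffel (fun y => Real.exp (2 * S y) • G y) m i j z = christoffel G m i j z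
      - s z * ((1 : Matrix (Fin n) (Fin n) ℝ) m j * w i z
        + (1 : Matrix (Fin n) (Fin n) ℝ) m i * w j z - G z i j * U m z) := by
  have hdet := h.det_ne_zero z hz
  have hS := h.differentiableAt h.contDiffOn_potential hz
  have hd : ∀ k a b, pderiv k (fun y => (Real.exp (2 * S y) • G y) a b) z =
      Real.exp (2 * S z) * (pderiv k (fun y => G y a b) z - 2 * w k z * s z * G z a b) := by
    intro k a b
    simp only [Matrix.smul_apply, smul_eq_mul]
    rw [pderiv_mul (hS.const_mul 2).exp (h.differentiableAt (h.contDiffOn_metric a b) hz),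
      pderiv_exp (hS.const_mul 2), pderiv_const_mul 2 hS, h.grad z hz]
    ring
  have hinv : (Real.exp (2 * S z) • G z)⁻¹ = (Real.exp (2 * S z))⁻¹ • (G z)⁻¹ := by
    refine Matrix.inv_eq_left_inv ?_
    rw [Matrix.smul_mul, Matrix.mul_smul, smul_smul,
      Matrix.nonsing_inv_mul _ (isUnit_iff_ne_zero.2 hdet), inv_mul_cancel₀ (Real.exp_ne_zero _),
      one_smul]
  have hm : ∀ b, ∑ p, (G z)⁻¹ m p * G z p b = (1 : Matrix (Fin n) (Fin n) ℝ) m b := by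
    intro b
    rw [← Matrix.nonsing_inv_mul _ (isUnit_iff_ne_zero.2 hdet), Matrix.mul_apply]
  unfold christoffel
  simp only [hd]
  simp only [hinv, Matrix.smul_apply, smul_eq_mul]
  -- With δ and `U` written as contractions of the inverse metric, both sides are sums over `p` that
  -- agree term by term; the factors e^{2S} and e^{-2S} cancel.
  rw [← hm j, ← hm i, ← h.sum_inv_mul_lower hz m]
  simp only [Finset.mul_sum, Finset.sum_mul, ← Finset.sum_add_distrib, ← Finset.sum_sub_distrib]
  refine Finset.sum_congr rfl fun p _ => ?_
  field_simp
  ring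

/-- Differentiating e^S contributes -s w w, and the change of connection contributes s (2 w w + g).
Their sum s (g + w w) has the torse-forming shape and shifts φ by `s`. -/
lemma covDeriv_conformal (h : IsTorseFormingOn Ω G U w φ S s) (hz : z ∈ Ω) (k l : Fin n) :
    covDeriv (fun y => Real.exp (2 * S y) • G y) (fun i y => Real.exp (S y) * w i y) k l z =
      Real.exp (S z) * (φ z + s z) * (G z k l + w k z * w l z) := by
  have hS := h.differentiableAt h.contDiffOn_potential hz
  unfold covDeriv
  rw [pderiv_mul hS.exp (h.differentiableAt (h.contDiffOn_lower l) hz), pderiv_exp hS,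
    h.grad z hz, h.pderiv_lower hz]
  simp only [h.christoffel_conformal hz]
  have e : ∑ m, (christoffel G m k l z - s z * ((1 : Matrix (Fin n) (Fin n) ℝ) m l * w k z
        + (1 : Matrix (Fin n) (Fin n) ℝ) m k * w l z - G z k l * U m z)) *
        (Real.exp (S z) * w m z) =
      Real.exp (S z) * (∑ m, christoffel G m k l z * w m z
        - s z * (∑ m, (1 : Matrix (Fin n) (Fin n) ℝ) m l * w m z * w k z
          + ∑ m, (1 : Matrix (Fin n) (Fin n) ℝ) m k * w m z * w l z
          - G z k l * ∑ m, w m z * U m z)) := by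
    simp only [Finset.mul_sum, ← Finset.sum_add_distrib, ← Finset.sum_sub_distrib]
    exact Finset.sum_congr rfl fun m _ => by ring
  rw [e, h.unit z hz]
  simp only [Matrix.one_apply, ite_mul, one_mul, zero_mul, Finset.sum_ite_eq', Finset.mem_univ,
    if_true]
  ring

/-! ### Contractions of the deformation and the Ricci tensor -/

/-- The contraction of a deformation `D = δ ⊗ a + a ⊗ δ - g U` of a connection in one index. -/
lemma sum_deformation (m : Fin n → ℝ) (j k : Fin n) (a b : Fin n → ℝ) (c : ℝ) :
    ∑ p, m p * ((1 : Matrix (Fin n) (Fin n) ℝ) p k * a j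
        + (1 : Matrix (Fin n) (Fin n) ℝ) p j * a k - c * b p) =
      m k * a j + m j * a k - c * ∑ p, m p * b p := by
  simp only [mul_sub, mul_add, Finset.sum_sub_distrib, Finset.sum_add_distrib, Matrix.one_apply,
    ite_mul, one_mul, zero_mul, mul_ite, mul_zero, Finset.sum_ite_eq', Finset.mem_univ, if_true,
    Finset.mul_sum]
  congr 1
  exact Finset.sum_congr rfl fun p _ => by ring

/-- The three terms of D have traces w, n w and -w, so its trace is n w. -/
lemma trace_christoffel_conformal (h : IsTorseFormingOn Ω G U w φ S s) (hz : z ∈ Ω)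
    (k : Fin n) :
    ∑ m, christoffel (fun y => Real.exp (2 * S y) • G y) m m k z =
      ∑ m, christoffel G m m k z - n * (s z * w k z) := by
  simp only [h.christoffel_conformal hz, Finset.sum_sub_distrib, ← Finset.mul_sum,
    Finset.sum_add_distrib, Matrix.one_apply, ite_mul, one_mul, zero_mul, Finset.sum_ite_eq',
    Finset.mem_univ, if_true, Finset.sum_const, Finset.card_univ, Fintype.card_fin, nsmul_eq_mul]
  simp only [h.symm z _ k, ← h.lower_eq z hz]
  ring

/-- The constants `c` and `d` stand for the Kronecker deltas in D. -/
lemma pderiv_deformation (h : IsTorseFormingOn Ω G U w φ S s) (hz : z ∈ Ω) (c d : ℝ)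
    (q j k m : Fin n) :
    pderiv q (fun y => c * w j y + d * w k y - G y j k * U m y) z =
      c * pderiv q (w j) z + d * pderiv q (w k) z
        - (pderiv q (fun y => G y j k) z * U m z + G z j k * pderiv q (U m) z) := by
  have hw := fun i => h.differentiableAt (h.contDiffOn_lower i) hz
  have hG := h.differentiableAt (h.contDiffOn_metric j k) hz
  have hU := h.differentiableAt (h.contDiffOn_upper m) hz
  rw [pderiv_sub (((hw j).const_mul c).fun_add ((hw k).const_mul d)) (hG.fun_mul hU),
    pderiv_add ((hw j).const_mul c) ((hw k).const_mul d), pderiv_const_mul c (hw j),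
    pderiv_const_mul d (hw k), pderiv_mul hG hU]

/-- Trace of `pderiv_upper`: the identity matrix contributes `n` and the norm of `u` contributes -1.
-/
lemma divergence_upper (h : IsTorseFormingOn Ω G U w φ S s) (hz : z ∈ Ω) :
    ∑ m, pderiv m (U m) z =
      -∑ p, (∑ m, christoffel G m m p z) * U p z + φ z * (n - 1) := by
  simp only [h.pderiv_upper hz, Finset.sum_add_distrib, Finset.sum_neg_distrib, ← Finset.mul_sum,
    h.unit z hz, Matrix.one_apply, if_true, Finset.sum_const, Finset.card_univ, Fintype.card_fin,
    nsmul_eq_mul, Finset.sum_mul]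
  rw [Finset.sum_comm]
  ring

lemma pderiv_metric_mul_upper (h : IsTorseFormingOn Ω G U w φ S s) (hz : z ∈ Ω) (j k : Fin n) :
    ∑ m, pderiv m (fun y => G y j k) z * U m z =
      ∑ l, G z j l * ∑ m, christoffel G l k m z * U m z
        + ∑ l, G z k l * ∑ m, christoffel G l j m z * U m z := by
  simp only [pderiv_metric h.symm (h.det_ne_zero z hz), add_mul, Finset.sum_add_distrib,
    Finset.sum_mul, Finset.mul_sum]
  congr 1 <;>
  · rw [Finset.sum_comm]
    refine Finset.sum_congr rfl fun a _ => Finset.sum_congr rfl fun b _ => ?_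
    rw [christoffel_comm h.symm a b]; ring

/-- The divergence `∂ₘ Dᵐⱼₖ` of the deformation of the connection. -/
lemma divergence_deformation (h : IsTorseFormingOn Ω G U w φ S s) (hz : z ∈ Ω) (j k : Fin n) :
    ∑ m, pderiv m (fun y => (1 : Matrix (Fin n) (Fin n) ℝ) m k * w j y
        + (1 : Matrix (Fin n) (Fin n) ℝ) m j * w k y - G y j k * U m y) z =
      2 * ∑ m, christoffel G m j k z * w m z + 2 * φ z * (G z j k + w j z * w k z)
        - ∑ l, G z j l * ∑ m, christoffel G l k m z * U m z
        - ∑ l, G z k l * ∑ m, christoffel G l j m z * U m z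
        - G z j k * (-∑ p, (∑ m, christoffel G m m p z) * U p z + φ z * (n - 1)) := by
  simp only [h.pderiv_deformation hz]
  simp only [Finset.sum_sub_distrib, Finset.sum_add_distrib,
    h.pderiv_metric_mul_upper hz, ← Finset.mul_sum, h.divergence_upper hz, Matrix.one_apply,
    ite_mul, one_mul, zero_mul, Finset.sum_ite_eq', Finset.mem_univ, if_true, h.pderiv_lower hz]
  rw [h.symm z k j]
  simp only [fun m => christoffel_comm h.symm m k j z]
  ring

/-- One of the two cross terms Γ D in the last sum of `ricci`; the other is obtained by exchanging
`j` and `k`. -/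
lemma sum_christoffel_mul_deformation (h : IsTorseFormingOn Ω G U w φ S s)
    (j k : Fin n) :
    ∑ m, ∑ p, christoffel G m j p z * ((1 : Matrix (Fin n) (Fin n) ℝ) p k * w m z
        + (1 : Matrix (Fin n) (Fin n) ℝ) p m * w k z - G z m k * U p z) =
      ∑ m, christoffel G m j k z * w m z + (∑ m, christoffel G m m j z) * w k z
        - ∑ l, G z k l * ∑ m, christoffel G l j m z * U m z := by
  simp only [sum_deformation (fun p => christoffel G _ j p z) _ _ (fun i => w i z)
    (fun i => U i z), Finset.sum_sub_distrib, Finset.sum_add_distrib, Finset.sum_mul,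
    h.symm z _ k]
  simp only [fun m => christoffel_comm h.symm m j m z]

lemma sum_deformation_mul_deformation (h : IsTorseFormingOn Ω G U w φ S s) (hz : z ∈ Ω)
    (j k : Fin n) :
    ∑ m, ∑ p, ((1 : Matrix (Fin n) (Fin n) ℝ) m p * w j z
        + (1 : Matrix (Fin n) (Fin n) ℝ) m j * w p z - G z j p * U m z) *
        ((1 : Matrix (Fin n) (Fin n) ℝ) p k * w m z
        + (1 : Matrix (Fin n) (Fin n) ℝ) p m * w k z - G z m k * U p z) =
      (n + 2) * (w j z * w k z) + 2 * G z j k := by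
  have hw : ∀ i, ∑ p, G z i p * U p z = w i z := fun i => (h.lower_eq z hz i).symm
  have hw' : ∀ i, ∑ p, G z p i * U p z = w i z := fun i => by
    simp only [h.symm z _ i, hw]
  have hu := h.unit z hz
  have hone : ∀ m, ∑ p, (1 : Matrix (Fin n) (Fin n) ℝ) m p * U p z = U m z := fun m => by
    simp [Matrix.one_apply]
  simp only [sum_deformation (fun p => (1 : Matrix (Fin n) (Fin n) ℝ) _ p * w j z
        + (1 : Matrix (Fin n) (Fin n) ℝ) _ j * w p z - G z j p * U _ z) _ _ (fun i => w i z)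
    (fun i => U i z)]
  -- D contracted with `U` in a lower index is -δ, since the two w U terms cancel.
  have inner : ∀ m, ∑ p, ((1 : Matrix (Fin n) (Fin n) ℝ) m p * w j z
        + (1 : Matrix (Fin n) (Fin n) ℝ) m j * w p z - G z j p * U m z) * U p z =
      - (1 : Matrix (Fin n) (Fin n) ℝ) m j := by
    intro m
    have : ∑ p, ((1 : Matrix (Fin n) (Fin n) ℝ) m p * w j z
        + (1 : Matrix (Fin n) (Fin n) ℝ) m j * w p z - G z j p * U m z) * U p z =
        (∑ p, (1 : Matrix (Fin n) (Fin n) ℝ) m p * U p z) * w j z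
        + (1 : Matrix (Fin n) (Fin n) ℝ) m j * (∑ p, w p z * U p z)
        - (∑ p, G z j p * U p z) * U m z := by
      simp only [Finset.mul_sum, Finset.sum_mul, ← Finset.sum_add_distrib,
        ← Finset.sum_sub_distrib]
      exact Finset.sum_congr rfl fun p _ => by ring
    rw [this, hone, hu, hw]; ring
  simp only [inner]
  have expand : ∀ m, ((1 : Matrix (Fin n) (Fin n) ℝ) m k * w j z
        + (1 : Matrix (Fin n) (Fin n) ℝ) m j * w k z - G z j k * U m z) * w m z
        + ((1 : Matrix (Fin n) (Fin n) ℝ) m m * w j z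
        + (1 : Matrix (Fin n) (Fin n) ℝ) m j * w m z - G z j m * U m z) * w k z
        - G z m k * - (1 : Matrix (Fin n) (Fin n) ℝ) m j =
      (1 : Matrix (Fin n) (Fin n) ℝ) m k * (w m z * w j z)
      + (1 : Matrix (Fin n) (Fin n) ℝ) m j * (2 * w m z * w k z + G z m k)
      - G z j k * (w m z * U m z) + w j z * w k z - (G z j m * U m z) * w k z := by
    intro m; rw [Matrix.one_apply_eq]; ring
  simp only [expand, Finset.sum_sub_distrib, Finset.sum_add_distrib, ← Finset.mul_sum,
    ← Finset.sum_mul, hu, hw]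
  simp only [Matrix.one_apply, ite_mul, one_mul, zero_mul, Finset.sum_ite_eq', Finset.mem_univ,
    if_true, Finset.sum_const, Finset.card_univ, Fintype.card_fin, nsmul_eq_mul]
  ring

/-- The Ricci tensor of the rescaled metric `e^{2S} G`. -/
lemma ricci_conformal (h : IsTorseFormingOn Ω G U w φ S s) (hz : z ∈ Ω) (j k : Fin n) :
    ricci (fun y => Real.exp (2 * S y) • G y) j k z = ricci G j k z
      + ((n : ℝ) - 2) * (φ z * s z + s z ^ 2 - ∑ i, U i z * pderiv i s z) * (w j z * w k z)
      + ((2 * (n : ℝ) - 3) * (φ z * s z) + ((n : ℝ) - 2) * s z ^ 2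
        + ∑ i, U i z * pderiv i s z) * G z j k := by
  have hs := h.differentiableAt h.contDiffOn_dot hz
  have hw := fun i => h.differentiableAt (h.contDiffOn_lower i) hz
  have hU := fun i => h.differentiableAt (h.contDiffOn_upper i) hz
  have hΓ := fun m i j => h.differentiableAt
    (contDiffOn_christoffel h.isOpen h.contDiffOn_metric h.det_ne_zero m i j) hz
  have hu := h.unit z hz
  have hD : ∀ m i j, DifferentiableAt ℝ (fun y => (1 : Matrix (Fin n) (Fin n) ℝ) m j * w i y
        + (1 : Matrix (Fin n) (Fin n) ℝ) m i * w j y - G y i j * U m y) z := fun m i j =>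
    (((hw i).const_mul _).fun_add ((hw j).const_mul _)).fun_sub
      ((h.differentiableAt (h.contDiffOn_metric i j) hz).fun_mul (hU m))
  set t := ∑ i, U i z * pderiv i s z with ht
  -- `A`, `B`, `C`, `D` are the four sums in `ricci`. The terms of first order in Γ are kept in a
  -- common form so that they cancel in the final `ring`.
  have A : ∑ m, pderiv m (christoffel (fun y => Real.exp (2 * S y) • G y) m j k) z =
      ∑ m, pderiv m (christoffel G m j k) z + 2 * t * (w j z * w k z) + t * G z j k
      - s z * (2 * ∑ m, christoffel G m j k z * w m z + 2 * φ z * (G z j k + w j z * w k z)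
        - ∑ l, G z j l * ∑ m, christoffel G l k m z * U m z
        - ∑ l, G z k l * ∑ m, christoffel G l j m z * U m z
        - G z j k * (-∑ p, (∑ m, christoffel G m m p z) * U p z + φ z * (n - 1))) := by
    rw [← h.divergence_deformation hz]
    simp only [fun m => (pderiv_congr h.isOpen
      (fun y hy => h.christoffel_conformal hy m j k) hz : pderiv m _ z = _),
      fun m => pderiv_sub (i := m) (hΓ m j k) (hs.fun_mul (hD m j k)),
      fun m => pderiv_mul (i := m) hs (hD m j k), Finset.sum_sub_distrib, Finset.sum_add_distrib,
      sum_deformation (fun p => pderiv p s z) j k (fun i => w i z) (fun i => U i z),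
      ← Finset.mul_sum]
    have : ∑ p, pderiv p s z * U p z = t := Finset.sum_congr rfl fun p _ => mul_comm _ _
    rw [this, h.pderiv_dot hz j, h.pderiv_dot hz k]
    ring
  have B : ∑ m, pderiv j (christoffel (fun y => Real.exp (2 * S y) • G y) m m k) z =
      ∑ m, pderiv j (christoffel G m m k) z + n * (t * (w j z * w k z))
      - n * s z * (∑ m, christoffel G m j k z * w m z + φ z * (G z j k + w j z * w k z)) := by
    rw [← h.pderiv_lower hz]
    have hΓ' : ∀ m, DifferentiableAt ℝ
        (christoffel (fun y => Real.exp (2 * S y) • G y) m m k) z := fun m =>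
      ((hΓ m m k).fun_sub (hs.fun_mul (hD m m k))).congr_of_eventuallyEq <|
        Filter.eventuallyEq_of_mem (h.isOpen.mem_nhds hz)
          fun y hy => h.christoffel_conformal hy m m k
    -- The trace is taken before differentiating, so only n s w has to be differentiated.
    rw [← pderiv_sum hΓ', pderiv_congr h.isOpen
      (fun y hy => h.trace_christoffel_conformal hy k) hz,
      pderiv_sub (DifferentiableAt.fun_sum fun m _ => hΓ m m k) ((hs.fun_mul (hw k)).const_mul _),
      pderiv_sum fun m => hΓ m m k, pderiv_const_mul _ (hs.fun_mul (hw k)), pderiv_mul hs (hw k),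
      h.pderiv_dot hz j]
    ring
  have C : ∑ m, ∑ p, christoffel (fun y => Real.exp (2 * S y) • G y) m m p z *
        christoffel (fun y => Real.exp (2 * S y) • G y) p j k z =
      ∑ m, ∑ p, christoffel G m m p z * christoffel G p j k z
      - s z * ((∑ m, christoffel G m m k z) * w j z + (∑ m, christoffel G m m j z) * w k z
        - G z j k * ∑ p, (∑ m, christoffel G m m p z) * U p z)
      - n * s z * ∑ m, christoffel G m j k z * w m z
      + n * s z ^ 2 * (2 * (w j z * w k z) + G z j k) := by
    -- With the sum over `m` innermost, the trace of Γ̄ factors out.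
    rw [Finset.sum_comm, Finset.sum_comm (f := fun m p => christoffel G m m p z * _)]
    simp only [← Finset.sum_mul, h.trace_christoffel_conformal hz]
    simp only [h.christoffel_conformal hz]
    rw [← sum_deformation (fun p => ∑ m, christoffel G m m p z) j k (fun i => w i z)
      (fun i => U i z)]
    -- The s² term is n times D contracted with `w`; w · U = -1 turns -g (w · U) into g.
    have e : 2 * (w j z * w k z) + G z j k =
        w k z * w j z + w j z * w k z - G z j k * ∑ p, w p z * U p z := by rw [hu]; ring
    rw [e, ← sum_deformation (fun i => w i z) j k (fun i => w i z) (fun i => U i z)]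
    simp only [Finset.mul_sum, ← Finset.sum_add_distrib, ← Finset.sum_sub_distrib]
    exact Finset.sum_congr rfl fun p _ => by ring
  have D : ∑ m, ∑ p, christoffel (fun y => Real.exp (2 * S y) • G y) m j p z *
        christoffel (fun y => Real.exp (2 * S y) • G y) p m k z =
      ∑ m, ∑ p, christoffel G m j p z * christoffel G p m k z
      - s z * (∑ m, christoffel G m j k z * w m z + (∑ m, christoffel G m m j z) * w k z
        - ∑ l, G z k l * ∑ m, christoffel G l j m z * U m z)
      - s z * (∑ m, christoffel G m j k z * w m z + (∑ m, christoffel G m m k z) * w j z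
        - ∑ l, G z j l * ∑ m, christoffel G l k m z * U m z)
      + s z ^ 2 * ((n + 2) * (w j z * w k z) + 2 * G z j k) := by
    have e2 := h.sum_christoffel_mul_deformation (z := z) k j
    rw [Finset.sum_comm] at e2
    simp only [fun m => christoffel_comm h.symm m k j z] at e2
    rw [← h.sum_christoffel_mul_deformation j k, ← e2,
      ← h.sum_deformation_mul_deformation hz j k]
    simp only [h.christoffel_conformal hz, Finset.mul_sum, ← Finset.sum_add_distrib,
      ← Finset.sum_sub_distrib]
    refine Finset.sum_congr rfl fun m _ => Finset.sum_congr rfl fun p _ => ?_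
    rw [christoffel_comm h.symm p m k, h.symm z p j]
    ring
  unfold ricci
  rw [A, B, C, D]
  ring

end IsTorseFormingOn

end Coordinates

/-! ### Coordinate vectors and smoothness in a chart -/

section Charts

variable {n : ℕ} {M : Type*} [TopologicalSpace M] [ChartedSpace (EuclideanSpace ℝ (Fin n)) M]
  {e : OpenPartialHomeomorph M (EuclideanSpace ℝ (Fin n))}
  {g : ∀ x : M, TangentSpace (𝓡 n) x →L[ℝ] TangentSpace (𝓡 n) x →L[ℝ] ℝ}
  {u : ∀ x : M, TangentSpace (𝓡 n) x} {z : EuclideanSpace ℝ (Fin n)}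

lemma mdifferentiable_of_mem_maximalAtlas (he : e ∈ IsManifold.maximalAtlas (𝓡 n) ∞ M) :
    e.MDifferentiable (𝓡 n) (𝓡 n) :=
  ⟨(contMDiffOn_of_mem_maximalAtlas he).mdifferentiableOn (by simp),
    (contMDiffOn_symm_of_mem_maximalAtlas he).mdifferentiableOn (by simp)⟩

lemma mfderiv_coordVec (he : e ∈ IsManifold.maximalAtlas (𝓡 n) ∞ M) (hz : z ∈ e.target)
    (i : Fin n) : mfderiv (𝓡 n) (𝓡 n) e (e.symm z) (coordVec e i z) =
      (EuclideanSpace.single i (1 : ℝ) : EuclideanSpace ℝ (Fin n)) :=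
  DFunLike.congr_fun ((mdifferentiable_of_mem_maximalAtlas he).comp_symm_deriv hz)
    (EuclideanSpace.single i (1 : ℝ))

/-- The expansion of a tangent vector in the coordinate basis. -/
lemma eq_sum_smul_coordVec (he : e ∈ IsManifold.maximalAtlas (𝓡 n) ∞ M) (hz : z ∈ e.target)
    (v : TangentSpace (𝓡 n) (e.symm z)) :
    v = ∑ i, (show EuclideanSpace ℝ (Fin n) from mfderiv (𝓡 n) (𝓡 n) e (e.symm z) v) i •
      coordVec e i z := by
  have hm := mdifferentiable_of_mem_maximalAtlas he
  refine hm.mfderiv_injective (e.map_target hz) ?_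
  rw [map_sum]
  simp only [map_smul, mfderiv_coordVec he hz]
  set c : EuclideanSpace ℝ (Fin n) := mfderiv (𝓡 n) (𝓡 n) e (e.symm z) v with hc
  have h : c = ∑ i, c i • EuclideanSpace.single i (1 : ℝ) := by
    ext j
    simp [Pi.single_apply]
  exact h

variable [IsManifold (𝓡 n) ∞ M]

/-- The coordinate field is the image of a constant field on ℝⁿ under the tangent map of `e.symm`.
-/
lemma contMDiffOn_coordVec (he : e ∈ IsManifold.maximalAtlas (𝓡 n) ∞ M) (i : Fin n) :
    ContMDiffOn (𝓡 n) (𝓡 n).tangent ∞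
      (fun z => (⟨e.symm z, coordVec e i z⟩ : TangentBundle (𝓡 n) M)) e.target := by
  have h1 := (contMDiffOn_symm_of_mem_maximalAtlas he).contMDiffOn_tangentMapWithin (m := ∞)
    (by simp) e.open_target.uniqueMDiffOn
  have h2 : ContMDiff (𝓡 n) (𝓡 n).tangent ∞ (fun z : EuclideanSpace ℝ (Fin n) =>
      (⟨z, EuclideanSpace.single i (1 : ℝ)⟩ : TangentBundle (𝓡 n) (EuclideanSpace ℝ (Fin n)))) :=
    contMDiff_vectorSpace_iff_contDiff.2 contDiff_const
  refine (h1.comp h2.contMDiffOn fun z hz => hz).congr fun z hz => ?_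
  simp only [Function.comp, tangentMapWithin, coordVec,
    mfderivWithin_of_isOpen e.open_target hz]

lemma contDiffOn_apply_section (hg : IsLorentzianMetric g)
    (he : e ∈ IsManifold.maximalAtlas (𝓡 n) ∞ M)
    {v w : ∀ z, TangentSpace (𝓡 n) (e.symm z)}
    (hv : ContMDiffOn (𝓡 n) (𝓡 n).tangent ∞
      (fun z => (⟨e.symm z, v z⟩ : TangentBundle (𝓡 n) M)) e.target)
    (hw : ContMDiffOn (𝓡 n) (𝓡 n).tangent ∞
      (fun z => (⟨e.symm z, w z⟩ : TangentBundle (𝓡 n) M)) e.target) :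
    ContDiffOn ℝ ∞ (fun z => g (e.symm z) (v z) (w z)) e.target := by
  rw [← contMDiffOn_iff_contDiffOn]
  intro z hz
  have h := ContMDiffWithinAt.clm_bundle_apply₂ (F₁ := EuclideanSpace ℝ (Fin n))
    (F₂ := EuclideanSpace ℝ (Fin n)) (F₃ := ℝ)
    (E₁ := fun x : M => TangentSpace (𝓡 n) x) (E₂ := fun x : M => TangentSpace (𝓡 n) x)
    (E₃ := Bundle.Trivial M ℝ) (b := e.symm)
    (ψ := fun z => g (e.symm z))
    ((hg.smooth.contMDiffAt.contMDiffWithinAt (s := Set.univ)).comp z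
      (contMDiffOn_symm_of_mem_maximalAtlas he z hz) (Set.mapsTo_univ _ _)) (hv z hz) (hw z hz)
  simp only [contMDiffWithinAt_totalSpace] at h
  exact h.2

end Charts

/-! ### Components of the fields in a chart, and the result on M -/

section Components

variable {n : ℕ} {M : Type*} [TopologicalSpace M] [ChartedSpace (EuclideanSpace ℝ (Fin n)) M]
  {e : OpenPartialHomeomorph M (EuclideanSpace ℝ (Fin n))}
  {g : ∀ x : M, TangentSpace (𝓡 n) x →L[ℝ] TangentSpace (𝓡 n) x →L[ℝ] ℝ}
  {u : ∀ x : M, TangentSpace (𝓡 n) x} {z : EuclideanSpace ℝ (Fin n)}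

lemma eq_sum_upperComp_smul_coordVec (he : e ∈ IsManifold.maximalAtlas (𝓡 n) ∞ M)
    (hz : z ∈ e.target) : u (e.symm z) = ∑ i, upperComp u e i z • coordVec e i z :=
  eq_sum_smul_coordVec he hz (u (e.symm z))

lemma pderiv_comp_symm (he : e ∈ IsManifold.maximalAtlas (𝓡 n) ∞ M) (hz : z ∈ e.target)
    {f : M → ℝ} (hf : MDifferentiableAt (𝓡 n) 𝓘(ℝ, ℝ) f (e.symm z)) (i : Fin n) :
    pderiv i (fun y => f (e.symm y)) z = mfderiv (𝓡 n) 𝓘(ℝ, ℝ) f (e.symm z) (coordVec e i z) := by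
  have h := mfderiv_comp z hf ((mdifferentiable_of_mem_maximalAtlas he).mdifferentiableAt_symm hz)
  rw [mfderiv_eq_fderiv] at h
  exact DFunLike.congr_fun h (EuclideanSpace.single i (1 : ℝ))

lemma dot_eq_sum (he : e ∈ IsManifold.maximalAtlas (𝓡 n) ∞ M) (hz : z ∈ e.target)
    {f : M → ℝ} (hf : MDifferentiableAt (𝓡 n) 𝓘(ℝ, ℝ) f (e.symm z)) :
    dot u f (e.symm z) = ∑ i, upperComp u e i z * pderiv i (fun y => f (e.symm y)) z := by
  rw [dot, eq_sum_upperComp_smul_coordVec (u := u) he hz, map_sum]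
  refine Finset.sum_congr rfl fun i _ => ?_
  rw [pderiv_comp_symm he hz hf, map_smul]
  rfl

lemma lowerComp_eq_sum (hg : ∀ (x : M) (v w : TangentSpace (𝓡 n) x), g x v w = g x w v)
    (he : e ∈ IsManifold.maximalAtlas (𝓡 n) ∞ M) (hz : z ∈ e.target) (i : Fin n) :
    lowerComp g u e i z = ∑ j, metricComp g e z i j * upperComp u e j z := by
  rw [lowerComp, hg, eq_sum_upperComp_smul_coordVec (u := u) he hz, map_sum]
  refine Finset.sum_congr rfl fun j _ => ?_
  rw [map_smul, smul_eq_mul, mul_comm]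
  rfl

lemma sum_lowerComp_mul_upperComp (he : e ∈ IsManifold.maximalAtlas (𝓡 n) ∞ M)
    (hz : z ∈ e.target) :
    ∑ i, lowerComp g u e i z * upperComp u e i z =
      g (e.symm z) (u (e.symm z)) (u (e.symm z)) := by
  conv_rhs => arg 2; rw [eq_sum_upperComp_smul_coordVec (u := u) he hz]
  rw [map_sum]
  refine Finset.sum_congr rfl fun j _ => ?_
  rw [map_smul, smul_eq_mul, mul_comm]
  rfl

lemma metricComp_symm (hg : ∀ (x : M) (v w : TangentSpace (𝓡 n) x), g x v w = g x w v)
    (z : EuclideanSpace ℝ (Fin n)) (i j : Fin n) :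
    metricComp g e z i j = metricComp g e z j i :=
  hg _ _ _

/-- Needed for the second derivative of σ along `u`: smoothness of `dot u σ` is established in
charts and must be carried back to M. -/
lemma mdifferentiableAt_of_comp_symm (he : e ∈ IsManifold.maximalAtlas (𝓡 n) ∞ M) {f : M → ℝ}
    (hf : ContDiffOn ℝ ∞ (fun y => f (e.symm y)) e.target) (hz : z ∈ e.target) :
    MDifferentiableAt (𝓡 n) 𝓘(ℝ, ℝ) f (e.symm z) := by
  have hx := e.map_target hz
  have h1 : ContMDiffOn (𝓡 n) 𝓘(ℝ, ℝ) ∞ (fun x => f (e.symm (e x))) e.source :=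
    hf.contMDiffOn.comp (contMDiffOn_of_mem_maximalAtlas he) fun x hx => e.map_source hx
  have h2 : ContMDiffOn (𝓡 n) 𝓘(ℝ, ℝ) ∞ f e.source :=
    h1.congr fun x hx => by rw [e.left_inv hx]
  exact (h2.contMDiffAt (e.open_source.mem_nhds hx)).mdifferentiableAt (by simp)

lemma metricComp_conformal (σ : M → ℝ) :
    metricComp (conformal σ g) e =
      fun y => Real.exp (2 * σ (e.symm y)) • metricComp g e y := rfl

lemma upperComp_rescale (σ : M → ℝ) (i : Fin n) :
    upperComp (rescale σ u) e i z = Real.exp (-σ (e.symm z)) * upperComp u e i z := by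
  simp only [upperComp, rescale, map_smul]
  rfl

lemma lowerComp_rescale (σ : M → ℝ) :
    lowerComp (conformal σ g) (rescale σ u) e =
      fun i y => Real.exp (σ (e.symm y)) * lowerComp g u e i y := by
  ext i y
  have h : lowerComp (conformal σ g) (rescale σ u) e i y =
      Real.exp (2 * σ (e.symm y)) * (Real.exp (-σ (e.symm y)) * lowerComp g u e i y) := by
    simp only [lowerComp, conformal, rescale, map_smul, smul_apply, smul_eq_mul]
    ring
  rw [h, ← mul_assoc, ← Real.exp_add]
  congr 2
  ring

variable [IsManifold (𝓡 n) ∞ M]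

/-- A kernel vector of the matrix gives a nonzero tangent vector orthogonal to every vector. It is
orthogonal to the time-like vector of the signature condition, hence of positive square, yet also
orthogonal to itself. -/
lemma det_metricComp_ne_zero (hg : IsLorentzianMetric g)
    (he : e ∈ IsManifold.maximalAtlas (𝓡 n) ∞ M) (hz : z ∈ e.target) :
    (metricComp g e z).det ≠ 0 := by
  intro hdet
  obtain ⟨c, hc, hGc⟩ := Matrix.exists_mulVec_eq_zero_iff.2 hdet
  set w : TangentSpace (𝓡 n) (e.symm z) := ∑ i, c i • coordVec e i z with hw
  have hbasis : ∀ i, g (e.symm z) (coordVec e i z) w = 0 := by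
    intro i
    rw [hw, map_sum]
    refine Eq.trans (Finset.sum_congr rfl fun j _ => ?_) (congrFun hGc i)
    rw [map_smul, smul_eq_mul, mul_comm]
    rfl
  have hall : ∀ v, g (e.symm z) v w = 0 := by
    intro v
    rw [hg.symm, eq_sum_smul_coordVec he hz v, map_sum]
    refine Finset.sum_eq_zero fun i _ => ?_
    rw [map_smul, hg.symm, hbasis, smul_zero]
  have hw0 : w ≠ 0 := by
    intro h0
    apply hc
    have h1 : mfderiv (𝓡 n) (𝓡 n) e (e.symm z) w =
        (∑ i, c i • EuclideanSpace.single i (1 : ℝ) : EuclideanSpace ℝ (Fin n)) := by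
      rw [hw, map_sum]
      simp only [map_smul, mfderiv_coordVec he hz]
      rfl
    rw [h0, map_zero] at h1
    ext j
    have h2 := congrArg (fun v : EuclideanSpace ℝ (Fin n) => v j) h1.symm
    have h3 : (0 : TangentSpace (𝓡 n) (e (e.symm z))) = (0 : EuclideanSpace ℝ (Fin n)) := rfl
    rw [h3] at h2
    simpa [Pi.single_apply] using h2
  obtain ⟨v, -, hv⟩ := hg.signature (e.symm z)
  exact (hv w hw0 (hall v)).ne' (hall w)

lemma contDiffOn_metricComp (hg : IsLorentzianMetric g)
    (he : e ∈ IsManifold.maximalAtlas (𝓡 n) ∞ M) (i j : Fin n) :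
    ContDiffOn ℝ ∞ (fun y => metricComp g e y i j) e.target :=
  contDiffOn_apply_section hg he (contMDiffOn_coordVec he i) (contMDiffOn_coordVec he j)

lemma contDiffOn_lowerComp (hg : IsLorentzianMetric g)
    (hu : ContMDiff (𝓡 n) (𝓡 n).tangent ∞ (fun x => (⟨x, u x⟩ : TangentBundle (𝓡 n) M)))
    (he : e ∈ IsManifold.maximalAtlas (𝓡 n) ∞ M) (i : Fin n) :
    ContDiffOn ℝ ∞ (lowerComp g u e i) e.target :=
  contDiffOn_apply_section hg he
    (hu.comp_contMDiffOn (contMDiffOn_symm_of_mem_maximalAtlas he)) (contMDiffOn_coordVec he i)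

/-- Raising the index of the smooth covariant components by the inverse metric recovers the
contravariant ones. -/
lemma contDiffOn_upperComp (hg : IsLorentzianMetric g)
    (hu : ContMDiff (𝓡 n) (𝓡 n).tangent ∞ (fun x => (⟨x, u x⟩ : TangentBundle (𝓡 n) M)))
    (he : e ∈ IsManifold.maximalAtlas (𝓡 n) ∞ M) (i : Fin n) :
    ContDiffOn ℝ ∞ (upperComp u e i) e.target := by
  refine (ContDiffOn.sum (s := Finset.univ) fun p _ => (contDiffOn_inv_apply (contDiffOn_metricComp hg he)
    (fun y hy => det_metricComp_ne_zero hg he hy) i p).mul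
      (contDiffOn_lowerComp hg hu he p)).congr fun y hy => ?_
  have : ∑ p, (metricComp g e y)⁻¹ i p * lowerComp g u e p y =
      (metricComp g e y)⁻¹.mulVec ((metricComp g e y).mulVec fun j => upperComp u e j y) i := by
    simp only [Matrix.mulVec, dotProduct, lowerComp_eq_sum hg.symm he hy]
  rw [this, Matrix.mulVec_mulVec, Matrix.nonsing_inv_mul _
    (isUnit_iff_ne_zero.2 (det_metricComp_ne_zero hg he hy)), Matrix.one_mulVec]

lemma contDiffOn_dot_comp_symm (hg : IsLorentzianMetric g)
    (hu : ContMDiff (𝓡 n) (𝓡 n).tangent ∞ (fun x => (⟨x, u x⟩ : TangentBundle (𝓡 n) M)))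
    (he : e ∈ IsManifold.maximalAtlas (𝓡 n) ∞ M) {f : M → ℝ}
    (hf : ContMDiff (𝓡 n) 𝓘(ℝ, ℝ) ∞ f) :
    ContDiffOn ℝ ∞ (fun y => dot u f (e.symm y)) e.target :=
  (ContDiffOn.sum fun i _ => (contDiffOn_upperComp hg hu he i).mul
    (contDiffOn_pderiv e.open_target (contMDiffOn_iff_contDiffOn.1
      (hf.comp_contMDiffOn (contMDiffOn_symm_of_mem_maximalAtlas he))))).congr
    fun _ hy => dot_eq_sum he hy (hf.mdifferentiable (by simp) _)

lemma IsGRWWith.isTorseFormingOn {φ σ : M → ℝ} (h : IsGRWWith g u φ)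
    (hσ : ContMDiff (𝓡 n) 𝓘(ℝ, ℝ) ∞ σ)
    (hdσ : ∀ (x : M) (v : TangentSpace (𝓡 n) x),
      mfderiv (𝓡 n) 𝓘(ℝ, ℝ) σ x v = -(g x (u x) v * dot u σ x))
    (he : e ∈ IsManifold.maximalAtlas (𝓡 n) ∞ M) :
    IsTorseFormingOn e.target (metricComp g e) (upperComp u e) (lowerComp g u e)
      (fun y => φ (e.symm y)) (fun y => σ (e.symm y)) (fun y => dot u σ (e.symm y)) where
  isOpen := e.open_target
  symm := metricComp_symm h.metric.symm
  contDiffOn_metric := contDiffOn_metricComp h.metric he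
  det_ne_zero _ hy := det_metricComp_ne_zero h.metric he hy
  contDiffOn_upper := contDiffOn_upperComp h.metric h.smooth he
  lower_eq _ hy := lowerComp_eq_sum h.metric.symm he hy
  unit _ hy := (sum_lowerComp_mul_upperComp he hy).trans (h.unit _)
  torse := h.torse e he
  contDiffOn_potential := contMDiffOn_iff_contDiffOn.1
    (hσ.comp_contMDiffOn (contMDiffOn_symm_of_mem_maximalAtlas he))
  contDiffOn_dot := contDiffOn_dot_comp_symm h.metric h.smooth he hσ
  grad _ hy i := (pderiv_comp_symm he hy (hσ.mdifferentiable (by simp) _) i).trans (hdσ _ _)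

lemma IsLorentzianMetric.conformal (hg : IsLorentzianMetric g) {σ : M → ℝ}
    (hσ : ContMDiff (𝓡 n) 𝓘(ℝ, ℝ) ∞ σ) : IsLorentzianMetric (conformal σ g) where
  smooth := by
    have h : ContMDiff (𝓡 n) 𝓘(ℝ, ℝ) ∞ (fun x => Real.exp (2 * σ x)) :=
      (Real.contDiff_exp.comp (contDiff_const.mul contDiff_id)).contMDiff.comp hσ
    exact h.smul_section hg.smooth
  symm x v w := congrArg (Real.exp (2 * σ x) * ·) (hg.symm x v w)
  signature x := by
    obtain ⟨v, hv, hw⟩ := hg.signature x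
    refine ⟨v, mul_neg_of_pos_of_neg (Real.exp_pos _) hv, fun w hw0 hvw => ?_⟩
    exact mul_pos (Real.exp_pos _)
      (hw w hw0 ((mul_eq_zero.1 hvw).resolve_left (Real.exp_ne_zero _)))

lemma contMDiff_rescale {σ : M → ℝ} (hσ : ContMDiff (𝓡 n) 𝓘(ℝ, ℝ) ∞ σ)
    (hu : ContMDiff (𝓡 n) (𝓡 n).tangent ∞ (fun x => (⟨x, u x⟩ : TangentBundle (𝓡 n) M))) :
    ContMDiff (𝓡 n) (𝓡 n).tangent ∞
      (fun x => (⟨x, rescale σ u x⟩ : TangentBundle (𝓡 n) M)) := by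
  have h : ContMDiff (𝓡 n) 𝓘(ℝ, ℝ) ∞ (fun x => Real.exp (-σ x)) :=
    (Real.contDiff_exp.comp contDiff_neg).contMDiff.comp hσ
  exact h.smul_section hu

lemma IsGRWWith.ricci_conformal {φ σ : M → ℝ} (h : IsGRWWith g u φ)
    (hσ : ContMDiff (𝓡 n) 𝓘(ℝ, ℝ) ∞ σ)
    (hdσ : ∀ (x : M) (v : TangentSpace (𝓡 n) x),
      mfderiv (𝓡 n) 𝓘(ℝ, ℝ) σ x v = -(g x (u x) v * dot u σ x))
    (he : e ∈ IsManifold.maximalAtlas (𝓡 n) ∞ M) (hz : z ∈ e.target) (i j : Fin n) :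
    ricci (metricComp (GRW.conformal σ g) e) i j z = ricci (metricComp g e) i j z
        + ((n : ℝ) - 2) *
            (φ (e.symm z) * dot u σ (e.symm z) + dot u σ (e.symm z) ^ 2
              - dot u (dot u σ) (e.symm z))
            * (lowerComp g u e i z * lowerComp g u e j z)
        + ((2 * (n : ℝ) - 3) * (φ (e.symm z) * dot u σ (e.symm z))
            + ((n : ℝ) - 2) * dot u σ (e.symm z) ^ 2
            + dot u (dot u σ) (e.symm z))
            * metricComp g e z i j := by
  have ht := h.isTorseFormingOn hσ hdσ he
  rw [metricComp_conformal, ht.ricci_conformal hz i j,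
    dot_eq_sum he hz (mdifferentiableAt_of_comp_symm he ht.contDiffOn_dot hz)]

lemma IsGRWWith.conformal {φ σ : M → ℝ} (h : IsGRWWith g u φ)
    (hσ : ContMDiff (𝓡 n) 𝓘(ℝ, ℝ) ∞ σ)
    (hdσ : ∀ (x : M) (v : TangentSpace (𝓡 n) x),
      mfderiv (𝓡 n) 𝓘(ℝ, ℝ) σ x v = -(g x (u x) v * dot u σ x)) :
    IsGRWWith (GRW.conformal σ g) (rescale σ u)
      (fun x => Real.exp (-σ x) * (φ x + dot u σ x)) where
  metric := h.metric.conformal hσ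
  smooth := contMDiff_rescale hσ h.smooth
  unit x := by
    have e : GRW.conformal σ g x (rescale σ u x) (rescale σ u x) =
        Real.exp (2 * σ x) * (Real.exp (-σ x) * (Real.exp (-σ x) * g x (u x) (u x))) := by
      simp only [GRW.conformal, rescale, map_smul, smul_apply, smul_eq_mul]
      ring
    rw [e, h.unit, ← mul_assoc, ← mul_assoc, ← Real.exp_add, ← Real.exp_add]
    ring_nf
    simp
  torse e he z hz k l := by
    rw [lowerComp_rescale, metricComp_conformal,
      (h.isTorseFormingOn hσ hdσ he).covDeriv_conformal hz]
    have h1 : Real.exp (2 * σ (e.symm z)) = Real.exp (σ (e.symm z)) * Real.exp (σ (e.symm z)) := by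
      rw [← Real.exp_add, two_mul]
    simp only [Matrix.smul_apply, smul_eq_mul, h1, Real.exp_neg]
    field_simp
  eigen := by
    obtain ⟨ξ, hξ⟩ := h.eigen
    -- The new eigenvalue is e^{-2σ} (ξ - A + B), with A and B the coefficients of w w and g: the
    -- sign of A comes from w · U = -1, and the exponential from ū having components e^{-σ} U and
    -- e^{σ} w.
    refine ⟨fun x => (Real.exp (-σ x)) ^ 2 * (ξ x
      - ((n : ℝ) - 2) * (φ x * dot u σ x + dot u σ x ^ 2 - dot u (dot u σ) x)
      + ((2 * (n : ℝ) - 3) * (φ x * dot u σ x) + ((n : ℝ) - 2) * dot u σ x ^ 2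
            + dot u (dot u σ) x)), fun e he z hz j => ?_⟩
    have ht := h.isTorseFormingOn hσ hdσ he
    simp only [h.ricci_conformal hσ hdσ he hz, upperComp_rescale, lowerComp_rescale]
    set A := ((n : ℝ) - 2) *
      (φ (e.symm z) * dot u σ (e.symm z) + dot u σ (e.symm z) ^ 2 - dot u (dot u σ) (e.symm z))
    set B := (2 * (n : ℝ) - 3) * (φ (e.symm z) * dot u σ (e.symm z))
      + ((n : ℝ) - 2) * dot u σ (e.symm z) ^ 2 + dot u (dot u σ) (e.symm z)
    have hsum : ∑ k, (ricci (metricComp g e) j k z + A * (lowerComp g u e j z * lowerComp g u e k z)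
          + B * metricComp g e z j k) * (Real.exp (-σ (e.symm z)) * upperComp u e k z) =
        Real.exp (-σ (e.symm z)) * (∑ k, ricci (metricComp g e) j k z * upperComp u e k z
          + A * lowerComp g u e j z * ∑ k, lowerComp g u e k z * upperComp u e k z
          + B * ∑ k, metricComp g e z j k * upperComp u e k z) := by
      simp only [Finset.mul_sum, ← Finset.sum_add_distrib]
      exact Finset.sum_congr rfl fun k _ => by ring
    rw [hsum, hξ e he z hz j, ht.unit z hz, ← ht.lower_eq z hz, Real.exp_neg]
    field_simp
    ring

end Components

end GRW

theorem theorem6p1 {n : ℕ} {M : Type*} [TopologicalSpace M]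
    [ChartedSpace (EuclideanSpace ℝ (Fin n)) M] [IsManifold (𝓡 n) ∞ M]
    (g : ∀ x : M, TangentSpace (𝓡 n) x →L[ℝ] TangentSpace (𝓡 n) x →L[ℝ] ℝ)
    (u : ∀ x : M, TangentSpace (𝓡 n) x) (φ : M → ℝ)
    (hgrw : GRW.IsGRWWith g u φ)
    (σ : M → ℝ) (hσ : ContMDiff (𝓡 n) 𝓘(ℝ, ℝ) ∞ σ)
    (hdσ : ∀ (x : M) (v : TangentSpace (𝓡 n) x),
      mfderiv (𝓡 n) 𝓘(ℝ, ℝ) σ x v = -(g x (u x) v * GRW.dot u σ x)) :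
    GRW.IsGRW (GRW.conformal σ g) ∧
    GRW.IsGRWWith (GRW.conformal σ g) (GRW.rescale σ u)
      (fun x => Real.exp (-σ x) * (φ x + GRW.dot u σ x)) ∧
    ∀ e ∈ IsManifold.maximalAtlas (𝓡 n) ∞ M, ∀ z ∈ e.target, ∀ i j : Fin n,
      GRW.ricci (GRW.metricComp (GRW.conformal σ g) e) i j z =
        GRW.ricci (GRW.metricComp g e) i j z
        + ((n : ℝ) - 2) *
            (φ (e.symm z) * GRW.dot u σ (e.symm z) + GRW.dot u σ (e.symm z) ^ 2
              - GRW.dot u (GRW.dot u σ) (e.symm z))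
            * (GRW.lowerComp g u e i z * GRW.lowerComp g u e j z)
        + ((2 * (n : ℝ) - 3) * (φ (e.symm z) * GRW.dot u σ (e.symm z))
            + ((n : ℝ) - 2) * GRW.dot u σ (e.symm z) ^ 2
            + GRW.dot u (GRW.dot u σ) (e.symm z))
            * GRW.metricComp g e z i j := by
  have h := hgrw.conformal hσ hdσ
  exact ⟨⟨_, _, h⟩, h, fun e he z hz i j => hgrw.ricci_conformal hσ hdσ he hz i j⟩
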